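/- Let $0<q<1$ and $0<z\le 1$ be real, and put $\delta=\frac{2\pi i}{\log q}$ and $[x]_q=\frac{1-q^x}{1-q}$. The series $$\sum_{k=0}^{\infty}\frac{q^{s(k+1)}}{[k+z]_q^{\,s}}$$ converges absolutely for $\operatorname{Re}s>0$ and its sum has a meromorphic continuation to the whole $s$-plane, denoted $\zeta(s,z:q)$. Define the meromorphic function of $s$ $$\zeta^*(s,z:q)=\zeta(s,z:q)+\frac{(q-q^2)^s q^{-zs}}{\log q}\,\frac{\pi}{\sin \pi s},$$ with removable singularities removed. Let $s\in\mathbb C$ satisfy $\operatorname{Re}s<0$ and $s\ne -r+\delta l$ for all integers $r\ge 1$ and $l\ne 0$. Then $\zeta^*(\cdot,z:q)$ is holomorphic at $s$, the series below converges absolutely, and $$\zeta^*(s,z:q)=-\frac{1}{2\pi i}(q-q^2)^s q^{-zs}\,\Gamma(1-s)\sum_{l\in\mathbb Z,\ l\neq 0}\frac1l\,\frac{\Gamma(s+\delta l)}{\Gamma(\delta l)}\,e^{-2\pi i l z}.$$ -/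

import Mathlib

noncomputable section

/-- The `q`-number `[x]_q = (1 - q ^ x) / (1 - q)`. -/
def qNumber (q : ℝ) (x : ℂ) : ℂ := (1 - (q : ℂ) ^ x) / (1 - (q : ℂ))

/-- The `k`-th term `q ^ (s (k + 1)) / [k + z]_q ^ s` of the `q`-Hurwitz zeta series. For `0 < q < 1`
and `0 < Re z` the number `[k + z]_q` has positive real part, and the power is the principal one. -/
def qHurwitzTerm (q : ℝ) (z s : ℂ) (k : ℕ) : ℂ :=
  (q : ℂ) ^ (s * ((k : ℂ) + 1)) / qNumber q ((k : ℂ) + z) ^ s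

/-- `F` is the meromorphic continuation to `ℂ` of the `q`-Hurwitz zeta function: it is meromorphic
(in normal form, that is, analytic away from its poles and `0` at its poles), and it is the sum of
the defining series in the half plane `0 < Re s`. -/
def IsQHurwitzContinuation (q : ℝ) (z : ℂ) (F : ℂ → ℂ) : Prop :=
  MeromorphicNFOn F Set.univ ∧ ∀ s : ℂ, 0 < s.re → HasSum (qHurwitzTerm q z s) (F s)

open Classical in
/-- The `q`-Hurwitz zeta function `s ↦ ζ(s, z : q)`: the meromorphic continuation to the whole
plane of `∑ k, q ^ (s (k + 1)) / [k + z]_q ^ s`. -/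
def qHurwitzZeta (q : ℝ) (z : ℂ) : ℂ → ℂ :=
  if h : ∃ F : ℂ → ℂ, IsQHurwitzContinuation q z F then h.choose else 0

/-- The factor `(q - q²) ^ s * q ^ (-z s)`. -/
def qFactor (q : ℝ) (z s : ℂ) : ℂ :=
  ((q - q ^ 2 : ℝ) : ℂ) ^ s * (q : ℂ) ^ (-z * s)

/-- The function `ζ*(s, z : q) = ζ(s, z : q) + (q - q²) ^ s q ^ (-z s) / log q * π / sin (π s)`, as a
meromorphic function of `s` on `ℂ`: `toMeromorphicNFOn` gives it its limiting value at removable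
singularities (such as the negative integers, where poles of the two summands cancel). -/
def qHurwitzZetaStar (q : ℝ) (z : ℂ) : ℂ → ℂ :=
  toMeromorphicNFOn
    (fun s : ℂ => qHurwitzZeta q z s +
      qFactor q z s / (Real.log q : ℂ) * ((Real.pi : ℂ) / Complex.sin ((Real.pi : ℂ) * s)))
    Set.univ

/-- `δ = 2 π i / log q`. -/
def qDelta (q : ℝ) : ℂ := 2 * (Real.pi : ℂ) * Complex.I / (Real.log q : ℂ)

/-- The `l`-th term `(1 / l) * Γ(s + δ l) / Γ(δ l) * e ^ (-2 π i l z)`. -/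
def gammaTerm (q : ℝ) (z s : ℂ) (l : ℤ) : ℂ :=
  1 / (l : ℂ) * (Complex.Gamma (s + qDelta q * (l : ℂ)) / Complex.Gamma (qDelta q * (l : ℂ))) *
    Complex.exp (-2 * (Real.pi : ℂ) * Complex.I * (l : ℂ) * z)

end

/-!
For `Re s > 0` the binomial series turns `∑ k, q ^ (s (k + z)) (1 - q ^ (k + z)) ^ (-s)` into
`∑ r, (s)_r / r! * q ^ ((s + r) z) / (1 - q ^ (s + r))` (`hasSum_qHurwitzTerm`). Since `q ^ z < 1`
this second series, `qSeries`, is meromorphic in `s` on the whole plane (`meromorphicAt_qSeries`),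
and multiplied by `qFactor` it gives the continuation `ζ(s, z : q)`.

For `Re s < 0` the coefficients `(s)_r / r!` are absolutely summable with sum `0`
(`exists_summable_bound_risingCoeff`, `hasSum_risingCoeff`), so for a fixed `s` off the poles the
series is a continuous function of `z` on `[0, 1]` with equal values at the end points. Integrating
term by term, its Fourier coefficients are `-1 / log q` times the values at `a = s + δ l` of
`∑ r, (s)_r / r! / (a + r)`. That sum is the beta function: it equals `Γ(a) Γ(1 - s) / Γ(a + 1 - s)`
by the beta integral for `Re a > 0`, and for all other `a` by the functional equation in `a`
(`betaSeries_eq_Gamma`). Summation by parts in `r` shows that the Fourier coefficients are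
absolutely summable over `l`, locally uniformly in `s` (`exists_summable_bound_betaSeries`); no
asymptotics of the Gamma function are needed. Hence the Fourier series represents the function, and its term
`l = 0` is `Γ(s) Γ(1 - s) = π / sin (π s)`, which is what `ζ*` removes (`qSeries_add_eq_tsum`).

At the negative integers this argument does not apply directly, but the identity holds on a
punctured neighbourhood of every admissible `s`, and the right-hand side is continuous there. So `ζ*` has
a finite limit at `s`; being in normal form it is holomorphic at `s` with that limit as its value.
-/

noncomputable section

open Filter Topology

/-! ### Coefficients of the binomial series -/

/-- The coefficient `(s)_r / r!` of `x ^ r` in the binomial series of `(1 - x) ^ (-s)`. -/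
def risingCoeff (s : ℂ) (r : ℕ) : ℂ := ∏ i ∈ Finset.range r, (s + i) / ((i : ℂ) + 1)

theorem risingCoeff_succ (s : ℂ) (r : ℕ) :
    risingCoeff s (r + 1) = risingCoeff s r * ((s + r) / ((r : ℂ) + 1)) := by
  rw [risingCoeff, Finset.prod_range_succ, risingCoeff]

theorem succ_mul_risingCoeff_succ (s : ℂ) (r : ℕ) :
    ((r : ℂ) + 1) * risingCoeff s (r + 1) = (s + r) * risingCoeff s r := by
  have : (r : ℂ) + 1 ≠ 0 := by exact_mod_cast Nat.succ_ne_zero r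
  rw [risingCoeff_succ]
  field_simp

theorem risingCoeff_eq_multichoose (s : ℂ) (r : ℕ) :
    risingCoeff s r = Ring.multichoose s r := by
  have h : (r.factorial : ℂ) * risingCoeff s r = r.factorial * Ring.multichoose s r := by
    rw [← nsmul_eq_mul _ (Ring.multichoose s r), Ring.factorial_nsmul_multichoose_eq_ascPochhammer,
      Polynomial.ascPochhammer_smeval_eq_eval]
    induction r with
    | zero => simp [risingCoeff]
    | succ r ih =>
      rw [ascPochhammer_succ_eval, ← ih, Nat.factorial_succ]
      push_cast
      linear_combination (r.factorial : ℂ) * succ_mul_risingCoeff_succ s r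
  exact mul_left_cancel₀ (by exact_mod_cast r.factorial_ne_zero) h

/-- The binomial series of `(1 - x) ^ (-s)` on the open unit disc. -/
theorem hasSum_risingCoeff_mul_pow (s : ℂ) {x : ℂ} (hx : ‖x‖ < 1) :
    HasSum (fun r => risingCoeff s r * x ^ r) ((1 - x) ^ (-s)) := by
  have h := (Complex.one_div_one_sub_cpow_hasFPowerSeriesOnBall_zero s).hasSum (y := x)
    (by simpa [enorm_eq_nnnorm, ← NNReal.coe_lt_coe] using hx)
  simp only [zero_add, one_div, ← Complex.cpow_neg] at h
  convert! h using 2 with r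
  rw [risingCoeff_eq_multichoose]
  simp [FormalMultilinearSeries.ofScalars, Ring.choose, mul_comm, sub_sub]

theorem summable_norm_risingCoeff_mul_pow (s : ℂ) {x : ℝ} (hx0 : 0 ≤ x) (hx : x < 1) :
    Summable (fun r => ‖risingCoeff s r‖ * x ^ r) := by
  have h := (hasSum_risingCoeff_mul_pow s (x := x)
    (by simpa [abs_of_nonneg hx0] using hx)).summable.norm
  simpa [abs_of_nonneg hx0] using h

theorem norm_risingCoeff (s : ℂ) (r : ℕ) :
    ‖risingCoeff s r‖ = ∏ i ∈ Finset.range r, ‖s + i‖ / ((i : ℝ) + 1) := by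
  rw [risingCoeff, norm_prod]
  refine Finset.prod_congr rfl fun i _ => ?_
  rw [norm_div, show ((i : ℂ) + 1) = ((i + 1 : ℕ) : ℂ) by push_cast; rfl, Complex.norm_natCast]
  push_cast; rfl

/-- Termwise comparison with a real parameter, uniform on discs around `0`. -/
theorem norm_risingCoeff_le {s : ℂ} {M : ℝ} (h : ‖s‖ ≤ M) (r : ℕ) :
    ‖risingCoeff s r‖ ≤ ‖risingCoeff (M : ℂ) r‖ := by
  rw [norm_risingCoeff, norm_risingCoeff]
  refine Finset.prod_le_prod (fun i _ => by positivity) fun i _ => ?_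
  gcongr
  have hM : (0 : ℝ) ≤ M := (norm_nonneg s).trans h
  calc ‖s + i‖ ≤ ‖s‖ + ‖(i : ℂ)‖ := norm_add_le _ _
    _ ≤ M + i := by simpa using h
    _ = ‖((M + i : ℝ) : ℂ)‖ := by rw [Complex.norm_real, Real.norm_of_nonneg (by positivity)]
    _ = ‖(M : ℂ) + i‖ := by push_cast; rfl

theorem differentiable_risingCoeff (r : ℕ) : Differentiable ℂ (fun s => risingCoeff s r) := by
  unfold risingCoeff
  fun_prop

/-- A form of Raabe's test. -/
theorem summable_of_raabe {u : ℕ → ℝ} (hu : ∀ r, 0 ≤ u r) {η : ℝ} (hη : 0 < η)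
    (h : ∀ᶠ r : ℕ in atTop, ((r : ℝ) + 1) * u (r + 1) ≤ (r - η) * u r) : Summable u := by
  obtain ⟨R, hR⟩ := eventually_atTop.1 h
  rw [← summable_nat_add_iff R]
  -- `η u r ≤ r u r - (r + 1) u (r + 1)`, and the right-hand side telescopes.
  have key : ∀ n : ℕ, ∑ i ∈ Finset.range n, η * u (i + R) ≤
      R * u R - ((n + R : ℕ) : ℝ) * u (n + R) := by
    intro n
    induction n with
    | zero => simp
    | succ n ih =>
      rw [Finset.sum_range_succ, show n + 1 + R = n + R + 1 by ring]
      have := hR (n + R) (by omega)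
      push_cast at this ih ⊢
      linarith
  have : Summable fun i => η * u (i + R) := by
    refine summable_of_sum_range_le (c := R * u R) (fun i => mul_nonneg hη.le (hu _)) fun n => ?_
    have h1 := key n
    have h2 : 0 ≤ ((n + R : ℕ) : ℝ) * u (n + R) := mul_nonneg (Nat.cast_nonneg _) (hu _)
    linarith
  exact (summable_mul_left_iff hη.ne').1 this

theorem eventually_norm_add_natCast_le {s : ℂ} (hs : s.re < 0) :
    ∀ᶠ r : ℕ in atTop, ‖s + r‖ ≤ r + s.re / 2 := by
  filter_upwards [eventually_ge_atTop ⌈(3 / 4 * s.re ^ 2 + s.im ^ 2) / (-s.re)⌉₊,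
    eventually_ge_atTop ⌈-s.re / 2⌉₊] with r h1 h2
  have h1 := Nat.ceil_le.1 h1
  have h2 := Nat.ceil_le.1 h2
  rw [div_le_iff₀ (by linarith)] at h1
  have h3 : (0 : ℝ) ≤ r + s.re / 2 := by linarith
  refine abs_le_of_sq_le_sq' ?_ h3 |>.2
  rw [Complex.sq_norm, Complex.normSq_apply]
  simp
  nlinarith

/-- In the left half plane the coefficients `(s)_r / r!` are absolutely summable over `r`, with a
majorant that is locally uniform in `s`. -/
theorem exists_summable_bound_risingCoeff {s₀ : ℂ} (hs : s₀.re < 0) :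
    ∃ ε > 0, ∃ u : ℕ → ℝ, Summable u ∧
      ∀ s, ‖s - s₀‖ ≤ ε → ∀ r, ‖risingCoeff s r‖ ≤ u r := by
  set ε : ℝ := -s₀.re / 4 with hε
  have hε0 : 0 < ε := by rw [hε]; linarith
  refine ⟨ε, hε0,
    fun r => ∏ i ∈ Finset.range r, (‖s₀ + i‖ + ε) / ((i : ℝ) + 1), ?_, ?_⟩
  · refine summable_of_raabe (fun r => Finset.prod_nonneg fun i _ => by positivity) hε0 ?_
    filter_upwards [eventually_norm_add_natCast_le hs] with r hr
    rw [Finset.prod_range_succ]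
    set P := ∏ i ∈ Finset.range r, (‖s₀ + i‖ + ε) / ((i : ℝ) + 1)
    have hP : 0 ≤ P := Finset.prod_nonneg fun i _ => by positivity
    have : ((r : ℝ) + 1) * (P * ((‖s₀ + r‖ + ε) / (r + 1))) = (‖s₀ + r‖ + ε) * P := by
      field_simp
    rw [this]
    gcongr
    linarith
  · intro s hs r
    rw [norm_risingCoeff]
    refine Finset.prod_le_prod (fun i _ => by positivity) fun i _ => ?_
    gcongr
    calc ‖s + i‖ = ‖(s₀ + i) + (s - s₀)‖ := by ring_nf
      _ ≤ _ := (norm_add_le _ _).trans (by gcongr)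

theorem summable_norm_risingCoeff {s : ℂ} (hs : s.re < 0) :
    Summable (fun r => ‖risingCoeff s r‖) := by
  obtain ⟨ε, hε, u, hu, h⟩ := exists_summable_bound_risingCoeff hs
  exact Summable.of_nonneg_of_le (fun _ => norm_nonneg _) (h s (by simpa using hε.le)) hu

/-- The partial sums of the binomial series at `x = 1` in closed form. -/
theorem mul_sum_range_risingCoeff (s : ℂ) (n : ℕ) :
    s * ∑ r ∈ Finset.range n, risingCoeff s r = n * risingCoeff s n := by
  induction n with
  | zero => simp
  | succ n ih =>
    rw [Finset.sum_range_succ, mul_add, ih]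
    push_cast
    rw [succ_mul_risingCoeff_succ]
    ring

theorem tendsto_natCast_mul_risingCoeff {s : ℂ} (hs : s.re < 0) :
    Tendsto (fun n : ℕ => (n : ℂ) * risingCoeff s n) atTop (𝓝 0) := by
  have hsum := summable_norm_risingCoeff hs
  have hlim : Tendsto (fun n : ℕ => (n : ℂ) * risingCoeff s n) atTop
      (𝓝 (s * ∑' r, risingCoeff s r)) := by
    simp_rw [← mul_sum_range_risingCoeff]
    exact (hsum.of_norm.hasSum.tendsto_sum_nat).const_mul s
  set L := s * ∑' r, risingCoeff s r
  -- The limit exists; a nonzero value would compare the coefficients with the harmonic series.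
  suffices L = 0 by rwa [this] at hlim
  by_contra hL
  have hL' : 0 < ‖L‖ := norm_pos_iff.2 hL
  refine Real.not_summable_one_div_natCast ?_
  refine Summable.of_norm_bounded_eventually (hsum.mul_left (2 / ‖L‖)) ?_
  rw [Nat.cofinite_eq_atTop]
  filter_upwards [hlim.norm.eventually_const_lt (half_lt_self hL'), eventually_gt_atTop 0]
    with n hn hn0
  have hn0' : (0 : ℝ) < n := by exact_mod_cast hn0
  rw [norm_mul (n : ℂ), Complex.norm_natCast] at hn
  rw [Real.norm_of_nonneg (by positivity), div_mul_eq_mul_div, div_le_div_iff₀ hn0' hL']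
  linarith

/-- The binomial series of `(1 - x) ^ (-s)` at the boundary point `x = 1`, where the function
vanishes because `Re s < 0`. -/
theorem hasSum_risingCoeff {s : ℂ} (hs : s.re < 0) : HasSum (risingCoeff s) 0 := by
  have h := (summable_norm_risingCoeff hs).of_norm
  have h0 : s ≠ 0 := by rintro rfl; simp at hs
  have h1 : Tendsto (fun n : ℕ => s * ∑ r ∈ Finset.range n, risingCoeff s r) atTop (𝓝 0) := by
    simp_rw [mul_sum_range_risingCoeff]
    exact tendsto_natCast_mul_risingCoeff hs
  have h2 := tendsto_nhds_unique (h.hasSum.tendsto_sum_nat.const_mul s) h1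
  have h3 := h.hasSum
  rwa [(mul_eq_zero.1 h2).resolve_left h0] at h3

/-! ### The partial fraction series of the beta function -/

/-- The series `∑ (s)_r / r! / (a + r)`, which for `Re s < 0` is the partial fraction expansion in
`a` of the (analytically continued) beta function `B(a, 1 - s)`. -/
def betaSeries (s a : ℂ) : ℂ := ∑' r : ℕ, risingCoeff s r / (a + r)

theorem summable_risingCoeff_mul {s : ℂ} (hs : s.re < 0) {g : ℕ → ℂ} {C : ℝ}
    (hg : ∀ r, ‖g r‖ ≤ C) : Summable fun r => risingCoeff s r * g r := by
  refine Summable.of_norm_bounded ((summable_norm_risingCoeff hs).mul_right C) fun r => ?_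
  rw [norm_mul]
  gcongr
  exact hg r

theorem tendsto_inv_add_natCast (a : ℂ) :
    Tendsto (fun r : ℕ => (a + r)⁻¹) atTop (𝓝 0) := by
  refine tendsto_inv₀_cobounded.comp ?_
  exact (tendsto_const_add_cobounded a).comp tendsto_natCast_atTop_cobounded

theorem exists_norm_inv_add_natCast_le (a : ℂ) : ∃ C, ∀ r : ℕ, ‖(a + r)⁻¹‖ ≤ C := by
  obtain ⟨C, hC⟩ := (tendsto_inv_add_natCast a).norm.bddAbove_range
  exact ⟨C, fun r => hC ⟨r, rfl⟩⟩

theorem exists_norm_natCast_div_add_le {a : ℂ} (ha : ∀ r : ℕ, a + r ≠ 0) :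
    ∃ C, ∀ r : ℕ, ‖(r : ℂ) / (a + r)‖ ≤ C := by
  obtain ⟨C, hC⟩ := exists_norm_inv_add_natCast_le a
  refine ⟨1 + ‖a‖ * C, fun r => ?_⟩
  have : (r : ℂ) / (a + r) = 1 - a * (a + r)⁻¹ := by
    have := ha r
    field_simp
    ring
  rw [this]
  refine (norm_sub_le _ _).trans ?_
  rw [norm_mul, norm_one]
  gcongr
  exact hC r

theorem summable_betaSeries {s : ℂ} (hs : s.re < 0) (a : ℂ) :
    Summable fun r : ℕ => risingCoeff s r / (a + r) := by
  obtain ⟨C, hC⟩ := exists_norm_inv_add_natCast_le a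
  exact summable_risingCoeff_mul hs hC

theorem summable_natCast_mul_risingCoeff_div {s : ℂ} (hs : s.re < 0) {a : ℂ}
    (ha : ∀ r : ℕ, a + r ≠ 0) :
    Summable fun r : ℕ => (r : ℂ) * risingCoeff s r / (a + r) := by
  obtain ⟨C, hC⟩ := exists_norm_natCast_div_add_le ha
  convert! summable_risingCoeff_mul hs hC using 2 with r
  ring

open MeasureTheory in
theorem betaSeries_eq_betaIntegral {s a : ℂ} (hs : s.re < 0) (ha : 0 < a.re) :
    betaSeries s a = Complex.betaIntegral a (1 - s) := by
  have hre : ∀ r : ℕ, -1 < (a + r - 1).re := fun r => by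
    have : (0 : ℝ) ≤ r := Nat.cast_nonneg r
    simp
    linarith
  set F : ℕ → ℝ → ℂ := fun r x => risingCoeff s r * (x : ℂ) ^ (a + r - 1)
  have hInt : ∀ r, IntegrableOn (F r) (Set.Ioo 0 1) := fun r => by
    have := (intervalIntegral.intervalIntegrable_cpow' (a := 0) (b := 1) (hre r)).const_mul
      (risingCoeff s r)
    rw [intervalIntegrable_iff_integrableOn_Ioo_of_le zero_le_one] at this
    exact this
  have hval : ∀ r, ∫ x in Set.Ioo (0 : ℝ) 1, F r x = risingCoeff s r / (a + r) := fun r => by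
    rw [← integral_Ioc_eq_integral_Ioo, ← intervalIntegral.integral_of_le zero_le_one,
      intervalIntegral.integral_const_mul, integral_cpow (Or.inl (hre r))]
    have h0 : a + r ≠ 0 := fun h => by
      have h1 := congrArg Complex.re h
      have : (0 : ℝ) ≤ r := Nat.cast_nonneg r
      simp at h1
      linarith
    simp [h0]
    ring
  have hnorm : ∀ r, ∫ x in Set.Ioo (0 : ℝ) 1, ‖F r x‖ = ‖risingCoeff s r‖ * (a.re + r)⁻¹ := by
    intro r
    have h1 : ∀ x ∈ Set.Ioo (0 : ℝ) 1, ‖F r x‖ = ‖risingCoeff s r‖ * x ^ (a.re + r - 1) := by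
      intro x hx
      rw [norm_mul, Complex.norm_cpow_eq_rpow_re_of_pos hx.1]
      simp
    have hr := hre r
    simp at hr
    rw [setIntegral_congr_fun measurableSet_Ioo h1, ← integral_Ioc_eq_integral_Ioo,
      ← intervalIntegral.integral_of_le zero_le_one, intervalIntegral.integral_const_mul,
      integral_rpow (Or.inl (by linarith))]
    have h0 : a.re + r ≠ 0 := by linarith
    simp [h0, Real.zero_rpow]
  have hsum : Summable fun r => ∫ x in Set.Ioo (0 : ℝ) 1, ‖F r x‖ := by
    simp_rw [hnorm]
    refine Summable.of_nonneg_of_le (fun r => by positivity) (fun r => ?_)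
      ((summable_norm_risingCoeff hs).mul_right a.re⁻¹)
    gcongr
    linarith [(Nat.cast_nonneg r : (0 : ℝ) ≤ r)]
  have h := hasSum_integral_of_summable_integral_norm (μ := volume.restrict (Set.Ioo 0 1)) hInt hsum
  simp_rw [hval] at h
  rw [betaSeries, h.tsum_eq, Complex.betaIntegral, intervalIntegral.integral_of_le zero_le_one,
    integral_Ioc_eq_integral_Ioo]
  refine setIntegral_congr_fun measurableSet_Ioo fun x hx => ?_
  have hx0 : (x : ℂ) ≠ 0 := by exact_mod_cast hx.1.ne'
  have h2 := (hasSum_risingCoeff_mul_pow s (x := x)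
    (by simpa [abs_of_pos hx.1] using hx.2)).mul_left ((x : ℂ) ^ (a - 1))
  rw [show 1 - s - 1 = -s by ring, ← h2.tsum_eq]
  refine tsum_congr fun r => ?_
  simp only [F]
  rw [show a + r - 1 = (a - 1) + r by ring, Complex.cpow_add _ _ hx0, Complex.cpow_natCast]
  ring

/-- The functional equation of `a ↦ B(a, 1 - s)`, read off from the series. -/
theorem mul_betaSeries {s a : ℂ} (hs : s.re < 0) (ha : ∀ r : ℕ, a + r ≠ 0) :
    a * betaSeries s a = (a + 1 - s) * betaSeries s (a + 1) := by
  have ha1 : ∀ r : ℕ, a + 1 + r ≠ 0 := fun r => by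
    have := ha (r + 1)
    push_cast at this
    rwa [add_assoc, add_comm 1]
  have h1 := summable_natCast_mul_risingCoeff_div hs ha
  -- `a / (a + r) = 1 - r / (a + r)`, and the coefficients sum to `0`.
  have e1 : a * betaSeries s a = -∑' r : ℕ, (r : ℂ) * risingCoeff s r / (a + r) := by
    rw [betaSeries, ← tsum_mul_left, ← zero_sub, ← (hasSum_risingCoeff hs).tsum_eq,
      ← (hasSum_risingCoeff hs).summable.tsum_sub h1]
    refine tsum_congr fun r => ?_
    have := ha r
    field_simp
    ring
  have e2 : (a + 1 - s) * betaSeries s (a + 1) =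
      -∑' r : ℕ, ((r + 1 : ℕ) : ℂ) * risingCoeff s (r + 1) / (a + (r + 1 : ℕ)) := by
    rw [betaSeries, ← tsum_mul_left]
    have h3 : Summable fun r : ℕ => ((r + 1 : ℕ) : ℂ) * risingCoeff s (r + 1) / (a + (r + 1 : ℕ)) :=
      (summable_nat_add_iff 1).2 h1
    rw [← zero_sub, ← (hasSum_risingCoeff hs).tsum_eq,
      ← (hasSum_risingCoeff hs).summable.tsum_sub h3]
    refine tsum_congr fun r => ?_
    have := ha1 r
    push_cast
    rw [succ_mul_risingCoeff_succ, show a + (r + 1 : ℂ) = a + 1 + r by ring]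
    field_simp
    ring
  rw [e1, e2, h1.tsum_eq_zero_add]
  simp

theorem betaSeries_eq_Gamma {s : ℂ} (hs : s.re < 0) {a : ℂ} (ha : ∀ r : ℕ, a + r ≠ 0) :
    betaSeries s a = Complex.Gamma a * Complex.Gamma (1 - s) / Complex.Gamma (a + 1 - s) := by
  obtain ⟨n, hn⟩ := exists_nat_gt (-a.re)
  -- Induction on a bound for `-Re a`, by the functional equation.
  induction n generalizing a with
  | zero =>
    have ha0 : 0 < a.re := by simpa using hn
    have hs1 : 0 < (1 - s).re := by simp; linarith
    rw [betaSeries_eq_betaIntegral hs ha0, Complex.Gamma_mul_Gamma_eq_betaIntegral ha0 hs1,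
      show a + 1 - s = a + (1 - s) by ring, mul_div_cancel_left₀]
    exact Complex.Gamma_ne_zero_of_re_pos (by simp at hs1 ⊢; linarith)
  | succ n ih =>
    have ha0 : a ≠ 0 := by simpa using ha 0
    have ha1 : ∀ r : ℕ, a + 1 + r ≠ 0 := fun r => by
      have := ha (r + 1)
      push_cast at this
      rwa [add_assoc, add_comm 1]
    have h1 := ih ha1 (by simp at hn ⊢; linarith)
    have h2 := mul_betaSeries hs ha
    rw [h1, Complex.Gamma_add_one a ha0, show a + 1 + 1 - s = (a + 1 - s) + 1 by ring] at h2
    by_cases h0 : a + 1 - s = 0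
    · rw [h0, Complex.Gamma_zero, div_zero]
      rw [h0, zero_mul] at h2
      exact (mul_eq_zero.1 h2).resolve_left ha0
    · rw [Complex.Gamma_add_one _ h0] at h2
      refine mul_left_cancel₀ ha0 (h2.trans ?_)
      by_cases hG : Complex.Gamma (a + 1 - s) = 0
      · simp [hG]
      · field_simp

/-- Summation by parts: the partial sums of `(s)_r / r!` are `(r + 1) (s)_{r + 1} / (r + 1)! / s`.
The new series has one more power of `a` in the denominators. -/
theorem mul_betaSeries_eq_tsum {s a : ℂ} (hs : s.re < 0) (ha : ∀ r : ℕ, a + r ≠ 0) :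
    s * betaSeries s a =
      ∑' r : ℕ, ((r : ℂ) + 1) * risingCoeff s (r + 1) / ((a + r) * (a + r + 1)) := by
  have h1 := summable_natCast_mul_risingCoeff_div hs ha
  have h1' := (summable_nat_add_iff 1).2 h1
  have h2 : ∑' r : ℕ, (((r + 1 : ℕ) : ℂ) * risingCoeff s (r + 1) / (a + (r + 1 : ℕ)) -
      (r : ℂ) * risingCoeff s r / (a + r)) = 0 := by
    rw [h1'.tsum_sub h1, h1.tsum_eq_zero_add]
    simp
  rw [betaSeries, ← tsum_mul_left, ← sub_zero (∑' r, _), ← h2,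
    ← ((summable_betaSeries hs a).mul_left s).tsum_sub (h1'.sub h1)]
  refine tsum_congr fun r => ?_
  have h3 := ha r
  have h4 : a + r + 1 ≠ 0 := by
    have := ha (r + 1)
    push_cast at this
    rwa [← add_assoc] at this
  have h5 := succ_mul_risingCoeff_succ s r
  push_cast
  rw [h5, ← add_assoc]
  field_simp
  ring

/-! ### Uniform bounds on arithmetic progressions in a vertical direction -/

/-- If none of the points `s + r + i D l` with `l ≠ 0` vanishes, their norms are bounded below by a
multiple of `r + 1 + |l|`. -/
theorem exists_add_one_add_abs_le_mul_norm {s : ℂ} {D : ℝ} (hD : D ≠ 0)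
    (h : ∀ (r : ℕ) (l : ℤ), l ≠ 0 → s + r + D * Complex.I * l ≠ 0) :
    ∃ C > 0, ∀ (r : ℕ) (l : ℤ), l ≠ 0 →
      (r : ℝ) + 1 + |(l : ℝ)| ≤ C * ‖s + r + D * Complex.I * l‖ := by
  set m : ℝ := min 1 |D| with hm
  have hm0 : 0 < m := lt_min one_pos (abs_pos.2 hD)
  set K : ℝ := |s.re| + |s.im| with hK
  obtain ⟨N, hN⟩ := exists_nat_gt (2 * K / m)
  set T : Finset (ℕ × ℤ) := Finset.range N ×ˢ Finset.Icc (-N : ℤ) N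
  set f : ℕ × ℤ → ℝ := fun p =>
    ((p.1 : ℝ) + 1 + |(p.2 : ℝ)|) / ‖s + p.1 + D * Complex.I * p.2‖ with hf
  have hf0 : ∀ p, 0 ≤ f p := fun p => by positivity
  have hT0 : 0 ≤ ∑ p ∈ T, f p := Finset.sum_nonneg fun p _ => hf0 p
  refine ⟨8 / m + ∑ p ∈ T, f p, by positivity, fun r l hl => ?_⟩
  set x := s + r + D * Complex.I * l with hx
  have hx0 : 0 < ‖x‖ := norm_pos_iff.2 (h r l hl)
  have hl1 : 1 ≤ |(l : ℝ)| := by exact_mod_cast Int.one_le_abs hl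
  have hr0 : (0 : ℝ) ≤ r := Nat.cast_nonneg r
  by_cases hp : (r, l) ∈ T
  · have h1 : f (r, l) ≤ ∑ p ∈ T, f p := Finset.single_le_sum (fun p _ => hf0 p) hp
    rw [hf] at h1
    simp only at h1
    rw [div_le_iff₀ hx0] at h1
    refine h1.trans ?_
    gcongr
    have : 0 ≤ 8 / m := by positivity
    linarith
  · -- Away from finitely many pairs the norm is at least a multiple of `r + |l|`.
    have h2 : (N : ℝ) ≤ r + |(l : ℝ)| := by
      simp only [T, Finset.mem_product, Finset.mem_range, Finset.mem_Icc, not_and_or, not_lt] at hp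
      have : (N : ℤ) ≤ r + |l| := by
        have h3 := le_abs_self l
        have h4 := neg_abs_le l
        have h5 := abs_nonneg l
        omega
      exact_mod_cast this
    have hre : (r : ℝ) - |s.re| ≤ ‖x‖ := by
      refine le_trans ?_ (Complex.abs_re_le_norm x)
      have : x.re = s.re + r := by simp [hx]
      rw [this]
      have := neg_abs_le s.re
      exact le_trans (by linarith) (le_abs_self _)
    have him : |D| * |(l : ℝ)| - |s.im| ≤ ‖x‖ := by
      refine le_trans ?_ (Complex.abs_im_le_norm x)
      have : x.im = s.im + D * l := by simp [hx]
      rw [this, ← abs_mul]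
      have := abs_sub_abs_le_abs_sub (D * l) (-s.im)
      rw [abs_neg, sub_neg_eq_add, add_comm (D * (l : ℝ))] at this
      exact this
    have h6 : m * r ≤ r := mul_le_of_le_one_left hr0 (min_le_left _ _)
    have h7 : m * |(l : ℝ)| ≤ |D| * |(l : ℝ)| := by gcongr; exact min_le_right _ _
    have h8 : 2 * K ≤ m * (r + |(l : ℝ)|) := by
      rw [div_lt_iff₀ hm0] at hN
      nlinarith
    have h9 : m * ((r : ℝ) + 1 + |(l : ℝ)|) ≤ 8 * ‖x‖ := by nlinarith
    have h10 : (r : ℝ) + 1 + |(l : ℝ)| ≤ 8 / m * ‖x‖ := by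
      rw [div_mul_eq_mul_div, le_div_iff₀ hm0]
      linarith
    refine h10.trans ?_
    gcongr
    linarith

/-- The kernel `m / ((m + k) (m + k + 1))`, with `m = r + 1`, has sum `1` over `k`, whatever
`m` is, so it preserves summability. -/
theorem summable_tsum_mul_div {w : ℕ → ℝ} (hw0 : ∀ r, 0 ≤ w r) (hw : Summable w) :
    (∀ k : ℕ, Summable fun r : ℕ =>
      w r * (((r : ℝ) + 1) / (((r : ℝ) + 1 + k) * (r + 1 + k + 1)))) ∧
    Summable fun k : ℕ => ∑' r : ℕ,
      w r * (((r : ℝ) + 1) / (((r : ℝ) + 1 + k) * (r + 1 + k + 1))) := by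
  set f : ℕ × ℕ → ℝ := fun p =>
    w p.1 * (((p.1 : ℝ) + 1) / (((p.1 : ℝ) + 1 + p.2) * (p.1 + 1 + p.2 + 1))) with hf
  have hf0 : ∀ p, 0 ≤ f p := fun p => mul_nonneg (hw0 _) (by positivity)
  -- The sum over `k` telescopes.
  have htel : ∀ r n : ℕ, ∑ k ∈ Finset.range n, f (r, k) ≤ w r := by
    intro r n
    have : ∑ k ∈ Finset.range n, f (r, k) = w r * (1 - ((r : ℝ) + 1) / (r + 1 + n)) := by
      induction n with
      | zero =>
        have : (r : ℝ) + 1 ≠ 0 := by positivity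
        simp [this]
      | succ n ih =>
        rw [Finset.sum_range_succ, ih, hf]
        have h1 : (r : ℝ) + 1 + n ≠ 0 := by positivity
        have h2 : (r : ℝ) + 1 + n + 1 ≠ 0 := by positivity
        push_cast
        rw [← add_assoc]
        field_simp
        ring
    rw [this]
    refine mul_le_of_le_one_right (hw0 r) ?_
    have : 0 ≤ ((r : ℝ) + 1) / (r + 1 + n) := by positivity
    linarith
  have hfs : Summable f := by
    refine (summable_prod_of_nonneg hf0).2 ⟨fun r => ?_, ?_⟩
    · exact summable_of_sum_range_le (fun k => hf0 _) (htel r)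
    · refine Summable.of_nonneg_of_le (fun r => tsum_nonneg fun k => hf0 _) (fun r => ?_) hw
      exact Real.tsum_le_of_sum_range_le (fun k => hf0 _) (htel r)
  have h := hfs.prod_symm
  exact ⟨fun k => h.prod_factor k, h.prod⟩

/-- The values of the beta series along `s + δ l`, `l ≠ 0`, are absolutely summable over `l`, with a
majorant that is locally uniform in `s`. -/
theorem exists_summable_bound_betaSeries {s₀ : ℂ} {D : ℝ} (hs : s₀.re < 0) (hD : D ≠ 0)
    (h : ∀ (r : ℕ) (l : ℤ), l ≠ 0 → s₀ + r + D * Complex.I * l ≠ 0) :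
    ∃ ε > 0, ∃ v : ℤ → ℝ, Summable v ∧ ∀ s, ‖s - s₀‖ ≤ ε → s.re < 0 ∧ ∀ l : ℤ, l ≠ 0 →
      (∀ r : ℕ, s + D * Complex.I * l + r ≠ 0) ∧ ‖betaSeries s (s + D * Complex.I * l)‖ ≤ v l := by
  obtain ⟨ε, hε, u, hu, hbound⟩ := exists_summable_bound_risingCoeff hs
  obtain ⟨C, hC, hlow⟩ := exists_add_one_add_abs_le_mul_norm hD h
  have hu0 : ∀ r, 0 ≤ u r := fun r => (norm_nonneg _).trans (hbound s₀ (by simpa using hε.le) r)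
  set B : ℝ := (2 * C) ^ 2 / (-s₀.re / 2) with hB
  have hσ : 0 < -s₀.re / 2 := by linarith
  have hB0 : 0 < B := by positivity
  obtain ⟨hV1, hV2⟩ := summable_tsum_mul_div (w := fun r => u (r + 1)) (fun r => hu0 _)
    ((summable_nat_add_iff 1).2 hu)
  set V : ℕ → ℝ := fun k => ∑' r : ℕ,
      u (r + 1) * (((r : ℝ) + 1) / (((r : ℝ) + 1 + k) * (r + 1 + k + 1))) with hV
  refine ⟨min ε (min (-s₀.re / 2) (1 / (2 * C))), by positivity,
    fun l => B * V l.natAbs, ?_, fun s hs' => ?_⟩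
  · refine Summable.mul_left B (Summable.of_nat_of_neg ?_ ?_) <;> simpa using hV2
  have hs1 : ‖s - s₀‖ ≤ ε := hs'.trans (min_le_left _ _)
  have hs2 : ‖s - s₀‖ ≤ -s₀.re / 2 := hs'.trans ((min_le_right _ _).trans (min_le_left _ _))
  have hs3 : ‖s - s₀‖ ≤ 1 / (2 * C) := hs'.trans ((min_le_right _ _).trans (min_le_right _ _))
  have hsre : s.re ≤ s₀.re / 2 := by
    have := (Complex.abs_re_le_norm _).trans hs2
    rw [Complex.sub_re] at this
    linarith [le_abs_self (s.re - s₀.re)]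
  have hs0 : s.re < 0 := by linarith
  have hsnorm : -s₀.re / 2 ≤ ‖s‖ := by
    have := (neg_le_abs s.re).trans (Complex.abs_re_le_norm s)
    linarith
  have hlow' : ∀ (r : ℕ) (l : ℤ), l ≠ 0 →
      (r : ℝ) + 1 + |(l : ℝ)| ≤ 2 * C * ‖s + D * Complex.I * l + r‖ := by
    intro r l hl
    have h1 := hlow r l hl
    have h2 : ‖s₀ + r + D * Complex.I * l‖ ≤ ‖s + D * Complex.I * l + r‖ + ‖s - s₀‖ := by
      refine le_trans (le_of_eq ?_) (norm_sub_le _ _)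
      ring_nf
    have h3 : C * ‖s - s₀‖ ≤ 1 / 2 := by
      rw [le_div_iff₀ (by positivity)] at hs3
      linarith
    have h4 : (0 : ℝ) ≤ r := Nat.cast_nonneg r
    have h5 := abs_nonneg (l : ℝ)
    nlinarith
  refine ⟨hs0, fun l hl => ?_⟩
  have hne : ∀ r : ℕ, s + D * Complex.I * l + r ≠ 0 := fun r h0 => by
    have := hlow' r l hl
    rw [h0, norm_zero, mul_zero] at this
    have : (0 : ℝ) < r + 1 + |(l : ℝ)| := by positivity
    linarith
  refine ⟨hne, ?_⟩
  set a := s + D * Complex.I * l with ha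
  have hnat : ((l.natAbs : ℕ) : ℝ) = |(l : ℝ)| := by
    rw [Nat.cast_natAbs, Int.cast_abs]
  have hterm : ∀ r : ℕ, ‖((r : ℂ) + 1) * risingCoeff s (r + 1) / ((a + r) * (a + r + 1))‖ ≤
      (2 * C) ^ 2 * (u (r + 1) * (((r : ℝ) + 1) /
        (((r : ℝ) + 1 + l.natAbs) * (r + 1 + l.natAbs + 1)))) := by
    intro r
    have h1 := hlow' r l hl
    have h2 := hlow' (r + 1) l hl
    push_cast at h2
    rw [← add_assoc] at h2
    have h3 : ‖a + r‖ ≠ 0 := norm_ne_zero_iff.2 (hne r)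
    have h4 : ‖a + r + 1‖ ≠ 0 := by
      have := hne (r + 1)
      push_cast at this
      rw [← add_assoc] at this
      exact norm_ne_zero_iff.2 this
    have h5 : ‖(r : ℂ) + 1‖ = r + 1 := by
      rw [show (r : ℂ) + 1 = ((r + 1 : ℕ) : ℂ) by push_cast; rfl, Complex.norm_natCast]
      push_cast
      rfl
    rw [norm_div, norm_mul, norm_mul, h5, hnat]
    have h6 : ((r : ℝ) + 1 + |(l : ℝ)|) * (r + 1 + |(l : ℝ)| + 1) ≤
        (2 * C) ^ 2 * (‖a + r‖ * ‖a + r + 1‖) := by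
      calc _ ≤ (2 * C * ‖a + r‖) * (2 * C * ‖a + r + 1‖) := by
            gcongr
            linarith
        _ = _ := by ring
    have h7 : ‖risingCoeff s (r + 1)‖ ≤ u (r + 1) := hbound s hs1 _
    rw [div_le_iff₀ (by positivity)]
    have h8 : 0 < ((r : ℝ) + 1 + |(l : ℝ)|) * (r + 1 + |(l : ℝ)| + 1) := by positivity
    calc ((r : ℝ) + 1) * ‖risingCoeff s (r + 1)‖ ≤ (r + 1) * u (r + 1) := by gcongr
      _ ≤ ((r + 1) * u (r + 1)) * (((2 * C) ^ 2 * (‖a + r‖ * ‖a + r + 1‖)) /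
          (((r : ℝ) + 1 + |(l : ℝ)|) * (r + 1 + |(l : ℝ)| + 1))) := by
        refine le_mul_of_one_le_right (mul_nonneg (by positivity) (hu0 _)) ?_
        rwa [one_le_div h8]
      _ = _ := by ring
  have hmul := mul_betaSeries_eq_tsum hs0 hne
  have hnorm : ‖s‖ * ‖betaSeries s a‖ ≤ (2 * C) ^ 2 * V l.natAbs := by
    rw [← norm_mul, hmul, hV, ← tsum_mul_left]
    exact tsum_of_norm_bounded ((hV1 l.natAbs).mul_left _).hasSum hterm
  change _ ≤ B * V l.natAbs
  rw [hB, div_mul_eq_mul_div, le_div_iff₀ hσ]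
  refine le_trans ?_ hnorm
  rw [mul_comm]
  gcongr

/-! ### The Fourier expansion in `z` -/

/-- The series `∑ (s)_r / r! * q ^ ((s + r) z) / (1 - q ^ (s + r))`, which continues
`∑ k, q ^ (s (k + z)) (1 - q ^ (k + z)) ^ (-s)` to the whole `s`-plane. -/
def qSeries (q : ℝ) (z s : ℂ) : ℂ :=
  ∑' r : ℕ, risingCoeff s r * ((q : ℂ) ^ ((s + r) * z) / (1 - (q : ℂ) ^ (s + r)))

theorem ofReal_cpow_eq_exp {q : ℝ} (hq : 0 < q) (w : ℂ) :
    (q : ℂ) ^ w = Complex.exp (Real.log q * w) := by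
  rw [Complex.cpow_def_of_ne_zero (by exact_mod_cast hq.ne'), Complex.ofReal_log hq.le]

theorem ofReal_cpow_eq_one_iff {q : ℝ} (hq : 0 < q) (hq1 : q ≠ 1) (w : ℂ) :
    (q : ℂ) ^ w = 1 ↔ ∃ l : ℤ, w = qDelta q * l := by
  have hl : (Real.log q : ℂ) ≠ 0 := by
    exact_mod_cast Real.log_ne_zero_of_pos_of_ne_one hq hq1
  rw [ofReal_cpow_eq_exp hq, Complex.exp_eq_one_iff]
  refine exists_congr fun n => ?_
  rw [qDelta, div_mul_eq_mul_div, eq_div_iff hl]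
  constructor <;> intro h <;> linear_combination h

theorem qDelta_eq (q : ℝ) : qDelta q = ((2 * Real.pi / Real.log q : ℝ) : ℂ) * Complex.I := by
  rw [qDelta]
  push_cast
  ring

theorem qDelta_re (q : ℝ) : (qDelta q).re = 0 := by simp [qDelta_eq]

theorem one_sub_cpow_ne_zero {q : ℝ} (hq : 0 < q) (hq1 : q ≠ 1) {w : ℂ}
    (h : ∀ l : ℤ, w + qDelta q * l ≠ 0) : 1 - (q : ℂ) ^ w ≠ 0 := by
  intro h0
  obtain ⟨l, hl⟩ := (ofReal_cpow_eq_one_iff hq hq1 w).1 (sub_eq_zero.1 h0).symm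
  refine h (-l) ?_
  rw [hl]
  push_cast
  ring

theorem exists_norm_inv_one_sub_cpow_le {q : ℝ} (hq : 0 < q) (hq1 : q < 1) (s : ℂ) :
    ∃ C, ∀ r : ℕ, ‖(1 - (q : ℂ) ^ (s + r))⁻¹‖ ≤ C := by
  have hq0 : (q : ℂ) ≠ 0 := by exact_mod_cast hq.ne'
  have h1 : Tendsto (fun r : ℕ => (q : ℂ) ^ (s + r)) atTop (𝓝 0) := by
    simp_rw [Complex.cpow_add _ _ hq0, Complex.cpow_natCast]
    rw [← mul_zero ((q : ℂ) ^ s)]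
    exact (tendsto_pow_atTop_nhds_zero_of_norm_lt_one
      (by simpa [abs_of_pos hq] using hq1)).const_mul _
  have h2 : Tendsto (fun r : ℕ => (1 - (q : ℂ) ^ (s + r))⁻¹) atTop (𝓝 (1 - 0)⁻¹) :=
    (h1.const_sub 1).inv₀ (by simp)
  obtain ⟨C, hC⟩ := h2.norm.bddAbove_range
  exact ⟨C, fun r => hC ⟨r, rfl⟩⟩

/-- A majorant for the terms of `qSeries` that is uniform in `x ∈ [0, 1]`. -/
theorem exists_norm_qSeries_term_le {q : ℝ} (hq : 0 < q) (hq1 : q < 1) {s : ℂ} (hs : s.re < 0) :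
    ∃ C, ∀ (r : ℕ) (x : ℝ), x ∈ Set.Icc (0 : ℝ) 1 →
      ‖risingCoeff s r * ((q : ℂ) ^ ((s + r) * x) / (1 - (q : ℂ) ^ (s + r)))‖ ≤
        ‖risingCoeff s r‖ * C := by
  obtain ⟨C, hC⟩ := exists_norm_inv_one_sub_cpow_le hq hq1 s
  refine ⟨q ^ s.re * C, fun r x hx => ?_⟩
  rw [norm_mul, div_eq_mul_inv, norm_mul]
  gcongr
  · rw [Complex.norm_cpow_eq_rpow_re_of_pos hq]
    refine Real.rpow_le_rpow_of_exponent_ge hq hq1.le ?_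
    have h1 : (0 : ℝ) ≤ r := Nat.cast_nonneg r
    have h2 : ((s + r) * (x : ℂ)).re = s.re * x + r * x := by simp [add_mul]
    rw [h2]
    nlinarith [hx.1, hx.2, mul_nonneg h1 hx.1]
  · exact hC r

theorem continuous_qSeries_term {q : ℝ} (hq : 0 < q) (s : ℂ) (r : ℕ) :
    Continuous fun x : ℝ =>
      risingCoeff s r * ((q : ℂ) ^ ((s + r) * x) / (1 - (q : ℂ) ^ (s + r))) := by
  simp_rw [ofReal_cpow_eq_exp hq]
  fun_prop

theorem continuousOn_qSeries {q : ℝ} (hq : 0 < q) (hq1 : q < 1) {s : ℂ} (hs : s.re < 0) :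
    ContinuousOn (fun x : ℝ => qSeries q x s) (Set.Icc 0 1) := by
  obtain ⟨C, hC⟩ := exists_norm_qSeries_term_le hq hq1 hs
  exact continuousOn_tsum (fun r => (continuous_qSeries_term hq s r).continuousOn)
    ((summable_norm_risingCoeff hs).mul_right C) fun r x hx => hC r x hx

/-- The series takes equal values at the end points of `[0, 1]`, because the coefficients
`(s)_r / r!` sum to `0`. -/
theorem qSeries_zero_eq_one {q : ℝ} (hq : 0 < q) (hq1 : q < 1) {s : ℂ} (hs : s.re < 0)
    (h : ∀ (r : ℕ) (l : ℤ), s + r + qDelta q * l ≠ 0) :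
    qSeries q (0 : ℝ) s = qSeries q (1 : ℝ) s := by
  obtain ⟨C, hC⟩ := exists_norm_qSeries_term_le hq hq1 hs
  have hsum : ∀ x : ℝ, x ∈ Set.Icc (0 : ℝ) 1 → Summable fun r : ℕ =>
      risingCoeff s r * ((q : ℂ) ^ ((s + r) * x) / (1 - (q : ℂ) ^ (s + r))) := fun x hx =>
    Summable.of_norm_bounded ((summable_norm_risingCoeff hs).mul_right C) fun r => hC r x hx
  rw [← sub_eq_zero, qSeries, qSeries, ← (hsum 0 (by simp)).tsum_sub (hsum 1 (by simp)),
    ← (hasSum_risingCoeff hs).tsum_eq]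
  refine tsum_congr fun r => ?_
  have h1 := one_sub_cpow_ne_zero hq hq1.ne (h r)
  rw [← mul_sub, ← sub_div]
  simp only [Complex.ofReal_zero, Complex.ofReal_one, mul_zero, mul_one, Complex.cpow_zero]
  rw [div_self h1, mul_one]

/-- The Fourier coefficients of one term. The factor `1 - q ^ w` cancels because the exponential has
period `1`. -/
theorem integral_fourier_mul_cpow {q : ℝ} (hq : 0 < q) (hq1 : q < 1) {w : ℂ}
    (h : ∀ l : ℤ, w + qDelta q * l ≠ 0) (n : ℤ) :
    ∫ x in (0 : ℝ)..1, Complex.exp (2 * Real.pi * Complex.I * n * x) *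
      ((q : ℂ) ^ (w * x) / (1 - (q : ℂ) ^ w)) = -(1 / (Real.log q : ℂ)) / (w + qDelta q * n) := by
  have hl : (Real.log q : ℂ) ≠ 0 := by
    exact_mod_cast Real.log_ne_zero_of_pos_of_ne_one hq hq1.ne
  have h1 := one_sub_cpow_ne_zero hq hq1.ne h
  have hc : Real.log q * w + 2 * Real.pi * Complex.I * n = Real.log q * (w + qDelta q * n) := by
    rw [qDelta]
    field_simp
  have h2 : ∀ x : ℝ, Complex.exp (2 * Real.pi * Complex.I * n * x) *
      ((q : ℂ) ^ (w * x) / (1 - (q : ℂ) ^ w)) =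
      Complex.exp ((Real.log q * (w + qDelta q * n)) * x) * (1 - (q : ℂ) ^ w)⁻¹ := by
    intro x
    rw [ofReal_cpow_eq_exp hq (w * x), ← hc, add_mul, Complex.exp_add]
    ring_nf
  simp_rw [h2]
  rw [intervalIntegral.integral_mul_const, integral_exp_mul_complex (mul_ne_zero hl (h n)), ← hc]
  simp only [Complex.ofReal_one, Complex.ofReal_zero, mul_one, mul_zero, Complex.exp_zero]
  rw [Complex.exp_add, ← ofReal_cpow_eq_exp hq,
    show 2 * Real.pi * Complex.I * n = n * (2 * Real.pi * Complex.I) by ring,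
    Complex.exp_int_mul_two_pi_mul_I, mul_one,
    show (n : ℂ) * (2 * Real.pi * Complex.I) = 2 * Real.pi * Complex.I * n by ring, hc]
  have := h n
  field_simp
  ring

theorem integral_fourier_mul_qSeries {q : ℝ} (hq : 0 < q) (hq1 : q < 1) {s : ℂ} (hs : s.re < 0)
    (h : ∀ (r : ℕ) (l : ℤ), s + r + qDelta q * l ≠ 0) (n : ℤ) :
    ∫ x in (0 : ℝ)..1, Complex.exp (2 * Real.pi * Complex.I * n * x) * qSeries q x s =
      -(1 / (Real.log q : ℂ)) * betaSeries s (s + qDelta q * n) := by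
  obtain ⟨C, hC⟩ := exists_norm_qSeries_term_le hq hq1 hs
  have hsub : Set.uIoc (0 : ℝ) 1 ⊆ Set.Icc 0 1 := by
    rw [Set.uIoc_of_le zero_le_one]
    exact Set.Ioc_subset_Icc_self
  have hexp : ∀ x : ℝ, ‖Complex.exp (2 * Real.pi * Complex.I * n * x)‖ = 1 := fun x => by
    rw [show 2 * Real.pi * Complex.I * n * x = ((2 * Real.pi * n * x : ℝ) : ℂ) * Complex.I by
      push_cast; ring]
    exact Complex.norm_exp_ofReal_mul_I _
  have hsC := (summable_norm_risingCoeff hs).mul_right C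
  have hH := intervalIntegral.hasSum_integral_of_dominated_convergence (a := 0) (b := 1)
    (μ := MeasureTheory.volume)
    (F := fun (r : ℕ) (x : ℝ) => Complex.exp (2 * Real.pi * Complex.I * n * x) *
      (risingCoeff s r * ((q : ℂ) ^ ((s + r) * x) / (1 - (q : ℂ) ^ (s + r)))))
    (f := fun x : ℝ => Complex.exp (2 * Real.pi * Complex.I * n * x) * qSeries q x s)
    (fun r _ => ‖risingCoeff s r‖ * C)
    (fun r => by
      have := continuous_qSeries_term hq s r
      exact Continuous.aestronglyMeasurable (by fun_prop))
    (fun r => Eventually.of_forall fun x hx => by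
      rw [norm_mul, hexp, one_mul]
      exact hC r x (hsub hx))
    (Eventually.of_forall fun x _ => hsC)
    (by simp)
    (Eventually.of_forall fun x hx =>
      (Summable.of_norm_bounded hsC fun r => hC r x (hsub hx)).hasSum.mul_left _)
  rw [← hH.tsum_eq, betaSeries, ← tsum_mul_left]
  refine tsum_congr fun r => ?_
  have h1 := integral_fourier_mul_cpow hq hq1 (h r) n
  rw [show s + qDelta q * n + r = s + r + qDelta q * n by ring]
  calc _ = ∫ x in (0 : ℝ)..1, risingCoeff s r * (Complex.exp (2 * Real.pi * Complex.I * n * x) *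
      ((q : ℂ) ^ ((s + r) * x) / (1 - (q : ℂ) ^ (s + r)))) := by
        congr 1
        ext x
        ring
    _ = _ := by
        rw [intervalIntegral.integral_const_mul, h1]
        ring

theorem summable_betaSeries_qDelta {q : ℝ} (hq : 0 < q) (hq1 : q < 1) {s : ℂ} (hs : s.re < 0)
    (h : ∀ (r : ℕ) (l : ℤ), l ≠ 0 → s + r + qDelta q * l ≠ 0) :
    Summable fun l : ℤ => betaSeries s (s + qDelta q * l) := by
  have hD : 2 * Real.pi / Real.log q ≠ 0 :=
    div_ne_zero (by positivity) (Real.log_ne_zero_of_pos_of_ne_one hq hq1.ne)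
  rw [qDelta_eq] at h ⊢
  obtain ⟨ε, hε, v, hv, hb⟩ := exists_summable_bound_betaSeries hs hD h
  refine Summable.of_norm_bounded_eventually hv ?_
  filter_upwards [(Set.finite_singleton (0 : ℤ)).compl_mem_cofinite] with l hl
  exact ((hb s (by simpa using hε.le)).2 l hl).2

/-- The Fourier series of `x ↦ qSeries q x s`: its coefficients are values of the beta function. -/
theorem hasSum_betaSeries_mul_exp {q : ℝ} (hq : 0 < q) (hq1 : q < 1) {s : ℂ} (hs : s.re < 0)
    (h : ∀ (r : ℕ) (l : ℤ), s + r + qDelta q * l ≠ 0) {z : ℝ} (hz0 : 0 ≤ z) (hz1 : z ≤ 1) :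
    HasSum (fun l : ℤ => -(1 / (Real.log q : ℂ)) * betaSeries s (s + qDelta q * l) *
      Complex.exp (-2 * Real.pi * Complex.I * l * z)) (qSeries q z s) := by
  have : Fact ((0 : ℝ) < 1) := ⟨one_pos⟩
  have hend := qSeries_zero_eq_one hq hq1 hs h
  set f : C(AddCircle (1 : ℝ), ℂ) := ⟨AddCircle.liftIco 1 0 fun x : ℝ => qSeries q x s,
    AddCircle.liftIco_zero_continuous hend (continuousOn_qSeries hq hq1 hs)⟩ with hf
  have hcoef : ∀ n : ℤ, fourierCoeff f n =
      -(1 / (Real.log q : ℂ)) * betaSeries s (s + qDelta q * (-n : ℤ)) := by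
    intro n
    rw [← integral_fourier_mul_qSeries hq hq1 hs h (-n)]
    change fourierCoeff (AddCircle.liftIco 1 0 fun x : ℝ => qSeries q x s) n = _
    rw [fourierCoeff_liftIco_eq, fourierCoeffOn_eq_integral]
    simp only [zero_add, sub_zero, div_one, one_smul, smul_eq_mul]
    congr 1
    ext x
    rw [fourier_coe_apply]
    simp
  have hsum : Summable (fourierCoeff f) := by
    rw [← (Equiv.neg ℤ).summable_iff]
    convert! (summable_betaSeries_qDelta hq hq1 hs fun r l _ => h r l).mul_left
      (-(1 / (Real.log q : ℂ))) using 2 with l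
    simp [hcoef]
  have hval : f (z : AddCircle (1 : ℝ)) = qSeries q z s := by
    rcases hz1.lt_or_eq with hz | rfl
    · exact AddCircle.liftIco_zero_coe_apply (f := fun x : ℝ => qSeries q x s) ⟨hz0, hz⟩
    · rw [← hend, show ((1 : ℝ) : AddCircle (1 : ℝ)) = ((0 : ℝ) : AddCircle (1 : ℝ)) by
        simp [AddCircle.coe_period]]
      exact AddCircle.liftIco_zero_coe_apply (f := fun x : ℝ => qSeries q x s) (by simp)
  have hF := has_pointwise_sum_fourier_series_of_summable hsum (z : AddCircle (1 : ℝ))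
  rw [hval, ← (Equiv.neg ℤ).hasSum_iff] at hF
  convert! hF using 2 with l
  simp only [Function.comp_apply, Equiv.neg_apply, hcoef, neg_neg, smul_eq_mul, fourier_coe_apply]
  congr 2
  push_cast
  ring

/-- The Fourier expansion with the constant term `Γ(s) Γ(1 - s) = π / sin (π s)` split off. -/
theorem qSeries_add_eq_tsum {q : ℝ} (hq : 0 < q) (hq1 : q < 1) {s : ℂ} (hs : s.re < 0)
    (h : ∀ (r : ℕ) (l : ℤ), s + r + qDelta q * l ≠ 0) {z : ℝ} (hz0 : 0 ≤ z) (hz1 : z ≤ 1) :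
    qSeries q z s + 1 / (Real.log q : ℂ) * (Real.pi / Complex.sin (Real.pi * s)) =
      -(1 / (Real.log q : ℂ)) * ∑' l : {l : ℤ // l ≠ 0}, betaSeries s (s + qDelta q * (l : ℤ)) *
        Complex.exp (-2 * Real.pi * Complex.I * (l : ℤ) * z) := by
  have hF := hasSum_betaSeries_mul_exp hq hq1 hs h hz0 hz1
  have h0 : betaSeries s s = Real.pi / Complex.sin (Real.pi * s) := by
    rw [betaSeries_eq_Gamma hs fun r => by simpa using h r 0, add_sub_cancel_left,
      Complex.Gamma_one, div_one, Complex.Gamma_mul_Gamma_one_sub]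
  set f : ℤ → ℂ := fun l => -(1 / (Real.log q : ℂ)) * betaSeries s (s + qDelta q * l) *
      Complex.exp (-2 * Real.pi * Complex.I * l * z) with hf
  have hs0 : f 0 = -(1 / (Real.log q : ℂ)) * (Real.pi / Complex.sin (Real.pi * s)) := by
    simp [hf, h0]
  have hS := hF.sub (hasSum_ite_eq (0 : ℤ) (f 0))
  have hind : (fun l : ℤ => f l - if l = 0 then f 0 else 0) = Set.indicator {l | l ≠ 0} f := by
    ext l
    by_cases hl : l = 0 <;> simp [hl]
  rw [hind, ← hasSum_subtype_iff_indicator] at hS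
  rw [← tsum_mul_left, ← sub_neg_eq_add, ← neg_mul, ← hs0, ← hS.tsum_eq]
  refine tsum_congr fun l => ?_
  simp [hf, mul_assoc]

/-! ### The meromorphic continuation -/

theorem differentiable_ofReal_cpow_mul {q : ℝ} (hq : 0 < q) (r : ℕ) (z : ℂ) :
    Differentiable ℂ fun s : ℂ => (q : ℂ) ^ ((s + r) * z) := by
  simp_rw [ofReal_cpow_eq_exp hq]
  fun_prop

theorem differentiable_one_sub_ofReal_cpow {q : ℝ} (hq : 0 < q) (r : ℕ) :
    Differentiable ℂ fun s : ℂ => 1 - (q : ℂ) ^ (s + r) := by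
  simp_rw [ofReal_cpow_eq_exp hq]
  fun_prop

theorem differentiable_qFactor {q : ℝ} (hq : 0 < q) (hq1 : q < 1) (z : ℂ) :
    Differentiable ℂ (qFactor q z) := by
  have h : 0 < q - q ^ 2 := by nlinarith
  unfold qFactor
  simp_rw [ofReal_cpow_eq_exp hq, ofReal_cpow_eq_exp h]
  fun_prop

/-- Near every point all but finitely many terms of `qSeries` are holomorphic, and these sum to a
holomorphic function. -/
theorem exists_analyticAt_tail_qSeries {q : ℝ} (hq : 0 < q) (hq1 : q < 1) {z : ℝ} (hz : 0 < z)
    (s₁ : ℂ) : ∃ (N : ℕ) (T : ℂ → ℂ), AnalyticAt ℂ T s₁ ∧ qSeries q z =ᶠ[𝓝 s₁] fun s =>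
      (∑ r ∈ Finset.range N,
        risingCoeff s r * ((q : ℂ) ^ ((s + r) * z) / (1 - (q : ℂ) ^ (s + r)))) + T s := by
  set M : ℝ := ‖s₁‖ + 1 with hM
  obtain ⟨N, hN⟩ := exists_nat_ge (M + 1)
  set f : ℕ → ℂ → ℂ := fun r s =>
    risingCoeff s r * ((q : ℂ) ^ ((s + r) * z) / (1 - (q : ℂ) ^ (s + r))) with hf
  have hx0 : 0 ≤ q ^ z := by positivity
  have hx1 : q ^ z < 1 := Real.rpow_lt_one hq.le hq1 hz
  set u : ℕ → ℝ := fun r => q ^ (-M * z) * (1 - q)⁻¹ * (‖risingCoeff (M : ℂ) r‖ * (q ^ z) ^ r)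
  have hu : Summable u := (summable_norm_risingCoeff_mul_pow (M : ℂ) hx0 hx1).mul_left _
  have hden : ∀ s ∈ Metric.ball s₁ 1, ∀ r : ℕ, 1 - q ≤ ‖1 - (q : ℂ) ^ (s + (r + N : ℕ))‖ := by
    intro s hs r
    have hsM : ‖s‖ ≤ M := by
      have := norm_add_le s₁ (s - s₁)
      rw [add_sub_cancel] at this
      rw [mem_ball_iff_norm] at hs
      linarith
    have h1 : ‖(q : ℂ) ^ (s + (r + N : ℕ))‖ ≤ q := by
      rw [Complex.norm_cpow_eq_rpow_re_of_pos hq]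
      refine (Real.rpow_le_rpow_of_exponent_ge hq hq1.le (?_ : (1 : ℝ) ≤ _)).trans_eq
        (Real.rpow_one q)
      have h2 := (neg_le_abs s.re).trans ((Complex.abs_re_le_norm s).trans hsM)
      have h3 : (0 : ℝ) ≤ r := Nat.cast_nonneg r
      simp
      linarith
    have h2 := norm_sub_norm_le (1 : ℂ) ((q : ℂ) ^ (s + (r + N : ℕ)))
    rw [norm_one] at h2
    linarith
  have hbound : ∀ (r : ℕ), ∀ s ∈ Metric.ball s₁ 1, ‖f (r + N) s‖ ≤ u (r + N) := by
    intro r s hs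
    have hsM : ‖s‖ ≤ M := by
      have := norm_add_le s₁ (s - s₁)
      rw [add_sub_cancel] at this
      rw [mem_ball_iff_norm] at hs
      linarith
    have h1 : ‖(q : ℂ) ^ ((s + (r + N : ℕ)) * z)‖ ≤ q ^ (-M * z) * (q ^ z) ^ (r + N) := by
      rw [Complex.norm_cpow_eq_rpow_re_of_pos hq, ← Real.rpow_mul_natCast hq.le, ← Real.rpow_add hq]
      refine Real.rpow_le_rpow_of_exponent_ge hq hq1.le ?_
      have h2 := (neg_le_abs s.re).trans ((Complex.abs_re_le_norm s).trans hsM)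
      rw [Complex.re_mul_ofReal, Complex.add_re, Complex.natCast_re]
      nlinarith
    have h3 := inv_anti₀ (by linarith : 0 < 1 - q) (hden s hs r)
    simp only [hf, u]
    rw [norm_mul, div_eq_mul_inv, norm_mul, norm_inv]
    calc _ ≤ ‖risingCoeff (M : ℂ) (r + N)‖ *
          ((q ^ (-M * z) * (q ^ z) ^ (r + N)) * (1 - q)⁻¹) := by
          gcongr
          exact norm_risingCoeff_le hsM _
      _ = _ := by ring
  have hu' : Summable fun r => u (r + N) := (summable_nat_add_iff N).2 hu
  refine ⟨N, fun s => ∑' r, f (r + N) s, ?_, ?_⟩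
  · have hd : DifferentiableOn ℂ (fun s => ∑' r, f (r + N) s) (Metric.ball s₁ 1) := by
      refine Complex.differentiableOn_tsum_of_summable_norm hu' (fun r s hs => ?_)
        Metric.isOpen_ball hbound
      refine DifferentiableAt.differentiableWithinAt ?_
      refine (differentiable_risingCoeff _ s).mul ?_
      refine (differentiable_ofReal_cpow_mul hq _ _ s).div
        (differentiable_one_sub_ofReal_cpow hq _ s) ?_
      exact norm_pos_iff.1 (lt_of_lt_of_le (by linarith) (hden s hs r))
    exact hd.analyticAt (Metric.ball_mem_nhds s₁ one_pos)
  · filter_upwards [Metric.ball_mem_nhds s₁ one_pos] with s hs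
    have h1 : Summable fun r => f r s :=
      (summable_nat_add_iff N).1 (Summable.of_norm_bounded hu' fun r => hbound r s hs)
    exact (h1.sum_add_tsum_nat_add N).symm

theorem meromorphicAt_qSeries {q : ℝ} (hq : 0 < q) (hq1 : q < 1) {z : ℝ} (hz : 0 < z) (s : ℂ) :
    MeromorphicAt (qSeries q z) s := by
  obtain ⟨N, T, hT, heq⟩ := exists_analyticAt_tail_qSeries hq hq1 hz s
  refine MeromorphicAt.congr ?_ (heq.symm.filter_mono nhdsWithin_le_nhds)
  refine MeromorphicAt.fun_add (MeromorphicAt.fun_sum fun r _ => ?_) hT.meromorphicAt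
  exact ((differentiable_risingCoeff r).analyticAt s).meromorphicAt.fun_mul
    (((differentiable_ofReal_cpow_mul hq r z).analyticAt s).meromorphicAt.fun_div
      ((differentiable_one_sub_ofReal_cpow hq r).analyticAt s).meromorphicAt)

theorem one_sub_cpow_ne_zero_of_re_pos {q : ℝ} (hq : 0 < q) (hq1 : q < 1) {w : ℂ} (hw : 0 < w.re) :
    1 - (q : ℂ) ^ w ≠ 0 := by
  refine one_sub_cpow_ne_zero hq hq1.ne fun l h => ?_
  have := congrArg Complex.re h
  simp [qDelta_re] at this
  linarith

theorem analyticAt_qSeries {q : ℝ} (hq : 0 < q) (hq1 : q < 1) {z : ℝ} (hz : 0 < z) {s : ℂ}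
    (hs : 0 < s.re) : AnalyticAt ℂ (qSeries q z) s := by
  obtain ⟨N, T, hT, heq⟩ := exists_analyticAt_tail_qSeries hq hq1 hz s
  refine AnalyticAt.congr ?_ heq.symm
  refine AnalyticAt.fun_add (Finset.analyticAt_fun_sum _ fun r _ => ?_) hT
  refine ((differentiable_risingCoeff r).analyticAt s).fun_mul
    (((differentiable_ofReal_cpow_mul hq r z).analyticAt s).fun_div
      ((differentiable_one_sub_ofReal_cpow hq r).analyticAt s) ?_)
  refine one_sub_cpow_ne_zero_of_re_pos hq hq1 ?_
  have : (0 : ℝ) ≤ r := Nat.cast_nonneg r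
  simp
  linarith

/-- All powers in the definition have positive real bases, so the exponent laws apply. -/
theorem qHurwitzTerm_eq {q : ℝ} (hq : 0 < q) (hq1 : q < 1) {z : ℝ} (hz : 0 < z) (s : ℂ) (k : ℕ) :
    qHurwitzTerm q z s k = qFactor q z s *
      ((q : ℂ) ^ (s * (k + z)) * (1 - (q : ℂ) ^ ((k : ℂ) + z)) ^ (-s)) := by
  have hkz : 0 < (k : ℝ) + z := by positivity
  have h1 : 0 < 1 - q ^ ((k : ℝ) + z) := sub_pos.2 (Real.rpow_lt_one hq.le hq1 hkz)
  have h2 : 0 < 1 - q := sub_pos.2 hq1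
  have e1 : (q : ℂ) ^ ((k : ℂ) + z) = ((q ^ ((k : ℝ) + z) : ℝ) : ℂ) := by
    rw [Complex.ofReal_cpow hq.le]
    push_cast
    rfl
  have e2 : qNumber q ((k : ℂ) + z) = (((1 - q ^ ((k : ℝ) + z)) / (1 - q) : ℝ) : ℂ) := by
    rw [qNumber, e1]
    push_cast
    rfl
  have e3 : (1 : ℂ) - (q : ℂ) ^ ((k : ℂ) + z) = ((1 - q ^ ((k : ℝ) + z) : ℝ) : ℂ) := by
    rw [e1]
    push_cast
    rfl
  have e4 : q - q ^ 2 = q * (1 - q) := by ring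
  rw [qHurwitzTerm, qFactor, e2, e3, e4, ofReal_cpow_eq_exp hq, ofReal_cpow_eq_exp (div_pos h1 h2),
    ofReal_cpow_eq_exp (mul_pos hq h2), ofReal_cpow_eq_exp hq, ofReal_cpow_eq_exp hq,
    ofReal_cpow_eq_exp h1, Real.log_div h1.ne' h2.ne', Real.log_mul hq.ne' h2.ne',
    ← Complex.exp_sub, ← Complex.exp_add, ← Complex.exp_add, ← Complex.exp_add]
  congr 1
  push_cast
  ring

theorem hasSum_qHurwitzTerm {q : ℝ} (hq : 0 < q) (hq1 : q < 1) {z : ℝ} (hz : 0 < z) {s : ℂ}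
    (hs : 0 < s.re) : HasSum (qHurwitzTerm q z s) (qFactor q z s * qSeries q z s) := by
  have hq0 : (q : ℂ) ≠ 0 := by exact_mod_cast hq.ne'
  -- Expand `(1 - q ^ (k + z)) ^ (-s)` and interchange the sums over `k` and `r`.
  set f : ℕ × ℕ → ℂ := fun p => risingCoeff s p.1 * (q : ℂ) ^ ((s + p.1) * (p.2 + z)) with hf
  have hx1 : q ^ z < 1 := Real.rpow_lt_one hq.le hq1 hz
  have hsum : Summable f := by
    have h1 := summable_norm_risingCoeff_mul_pow s (x := q ^ z) (by positivity) hx1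
    have h2 : Summable fun k : ℕ => q ^ (s.re * z) * (q ^ s.re) ^ k :=
      (summable_geometric_of_lt_one (by positivity) (Real.rpow_lt_one hq.le hq1 hs)).mul_left _
    refine Summable.of_norm_bounded
      (h1.mul_of_nonneg h2 (fun r => by positivity) fun k => by positivity) fun p => ?_
    simp only [hf]
    rw [norm_mul, Complex.norm_cpow_eq_rpow_re_of_pos hq, mul_assoc,
      ← Real.rpow_mul_natCast hq.le, ← Real.rpow_mul_natCast hq.le, ← Real.rpow_add hq,
      ← Real.rpow_add hq]
    refine mul_le_mul_of_nonneg_left (Real.rpow_le_rpow_of_exponent_ge hq hq1.le ?_)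
      (norm_nonneg _)
    have h3 : ((s + p.1) * ((p.2 : ℂ) + z)).re = (s.re + p.1) * (p.2 + z) := by
      rw [show ((p.2 : ℂ) + z) = ((p.2 + z : ℝ) : ℂ) by push_cast; rfl, Complex.re_mul_ofReal]
      simp
    rw [h3]
    have h4 : (0 : ℝ) ≤ p.1 * p.2 := by positivity
    nlinarith
  have hk : ∀ r : ℕ, HasSum (fun k => f (r, k))
      (risingCoeff s r * ((q : ℂ) ^ ((s + r) * z) / (1 - (q : ℂ) ^ (s + r)))) := by
    intro r
    have hre : 0 < (s + r).re := by
      have : (0 : ℝ) ≤ r := Nat.cast_nonneg r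
      simp
      linarith
    have h1 : ‖(q : ℂ) ^ (s + r)‖ < 1 := by
      rw [Complex.norm_cpow_eq_rpow_re_of_pos hq]
      exact Real.rpow_lt_one hq.le hq1 hre
    have h2 := ((hasSum_geometric_of_norm_lt_one h1).mul_left ((q : ℂ) ^ ((s + r) * z))).mul_left
      (risingCoeff s r)
    rw [← div_eq_mul_inv] at h2
    convert! h2 using 2 with k
    simp only [hf]
    rw [mul_add, Complex.cpow_add _ _ hq0, Complex.cpow_mul_nat, mul_comm (((q : ℂ) ^ (s + r)) ^ k)]
  have hr : ∀ k : ℕ, HasSum (fun r => f (r, k))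
      ((q : ℂ) ^ (s * (k + z)) * (1 - (q : ℂ) ^ ((k : ℂ) + z)) ^ (-s)) := by
    intro k
    have h1 : ‖(q : ℂ) ^ ((k : ℂ) + z)‖ < 1 := by
      rw [Complex.norm_cpow_eq_rpow_re_of_pos hq]
      refine Real.rpow_lt_one hq.le hq1 ?_
      simp
      positivity
    convert! (hasSum_risingCoeff_mul_pow s h1).mul_left ((q : ℂ) ^ (s * (k + z))) using 2 with r
    simp only [hf]
    rw [add_mul, Complex.cpow_add _ _ hq0, mul_comm (r : ℂ), Complex.cpow_mul_nat]
    ring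
  have hS := hsum.hasSum
  have h1 := hS.prod_fiberwise hk
  have h2 := ((Equiv.prodComm ℕ ℕ).hasSum_iff.2 hS).prod_fiberwise hr
  rw [← h1.tsum_eq] at h2
  convert! h2.mul_left (qFactor q z s) using 2 with k
  exact qHurwitzTerm_eq hq hq1 hz s k

theorem meromorphicOn_qFactor_mul_qSeries {q : ℝ} (hq : 0 < q) (hq1 : q < 1) {z : ℝ}
    (hz : 0 < z) : MeromorphicOn (fun s => qFactor q z s * qSeries q z s) Set.univ := fun s _ =>
  ((differentiable_qFactor hq hq1 z).analyticAt s).meromorphicAt.fun_mul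
    (meromorphicAt_qSeries hq hq1 hz s)

theorem isQHurwitzContinuation_qHurwitzZeta {q : ℝ} (hq : 0 < q) (hq1 : q < 1) {z : ℝ}
    (hz : 0 < z) : IsQHurwitzContinuation q z (qHurwitzZeta q z) := by
  have hex : ∃ F : ℂ → ℂ, IsQHurwitzContinuation q z F := by
    have hm := meromorphicOn_qFactor_mul_qSeries hq hq1 hz
    refine ⟨toMeromorphicNFOn (fun s => qFactor q z s * qSeries q z s) Set.univ,
      meromorphicNFOn_toMeromorphicNFOn _ _, fun s hs => ?_⟩
    have ha : AnalyticAt ℂ (fun s => qFactor q z s * qSeries q z s) s :=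
      ((differentiable_qFactor hq hq1 z).analyticAt s).fun_mul (analyticAt_qSeries hq hq1 hz hs)
    rw [toMeromorphicNFOn_eq_toMeromorphicNFAt hm (Set.mem_univ s),
      toMeromorphicNFAt_eq_self.2 ha.meromorphicNFAt]
    exact hasSum_qHurwitzTerm hq hq1 hz hs
  rw [qHurwitzZeta, dif_pos hex]
  exact hex.choose_spec

/-- Uniqueness of the continuation: two meromorphic functions on `ℂ` that agree on a half plane
agree near every point, up to isolated exceptions. -/
theorem qHurwitzZeta_eventuallyEq {q : ℝ} (hq : 0 < q) (hq1 : q < 1) {z : ℝ} (hz : 0 < z)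
    (s₀ : ℂ) : qHurwitzZeta q z =ᶠ[𝓝[≠] s₀] fun s => qFactor q z s * qSeries q z s := by
  obtain ⟨hNF, hsum⟩ := isQHurwitzContinuation_qHurwitzZeta hq hq1 hz
  set g : ℂ → ℂ := fun s => qHurwitzZeta q z s - qFactor q z s * qSeries q z s with hg
  have hm : MeromorphicOn g Set.univ := fun s hs =>
    (hNF.meromorphicOn s hs).fun_sub (meromorphicOn_qFactor_mul_qSeries hq hq1 hz s hs)
  have h1 : meromorphicOrderAt g 1 = ⊤ := by
    rw [meromorphicOrderAt_eq_top_iff]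
    refine Filter.Eventually.filter_mono nhdsWithin_le_nhds ?_
    have hopen : {s : ℂ | 0 < s.re} ∈ 𝓝 (1 : ℂ) :=
      (isOpen_lt continuous_const Complex.continuous_re).mem_nhds (by simp)
    filter_upwards [hopen] with s hs
    exact sub_eq_zero.2 ((hsum s hs).unique (hasSum_qHurwitzTerm hq hq1 hz hs))
  have h0 : meromorphicOrderAt g s₀ = ⊤ := by
    by_contra h
    exact hm.meromorphicOrderAt_ne_top_of_isPreconnected isPreconnected_univ (Set.mem_univ s₀)
      (Set.mem_univ 1) h h1
  filter_upwards [meromorphicOrderAt_eq_top_iff.1 h0] with s hs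
  exact sub_eq_zero.1 hs

/-! ### The formula for `ζ*` -/

theorem add_natCast_add_qDelta_mul_ne_zero {q : ℝ} {s : ℂ} (hs : s.re < 0)
    (h : ∀ (r : ℕ) (l : ℤ), 1 ≤ r → l ≠ 0 → s ≠ -(r : ℂ) + qDelta q * (l : ℂ)) (r : ℕ) (l : ℤ)
    (hl : l ≠ 0) : s + r + qDelta q * l ≠ 0 := by
  intro h0
  rcases r.eq_zero_or_pos with rfl | hr
  · have := congrArg Complex.re h0
    simp [qDelta_re] at this
    linarith
  · refine h r (-l) hr (neg_ne_zero.2 hl) ?_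
    push_cast
    linear_combination h0

theorem eventually_add_natCast_ne_zero (s₀ : ℂ) : ∀ᶠ s : ℂ in 𝓝[≠] s₀, ∀ r : ℕ, s + r ≠ 0 := by
  obtain ⟨N, hN⟩ := exists_nat_gt (‖s₀‖ + 1)
  have h1 : ∀ᶠ s in 𝓝[≠] s₀, ∀ r ∈ Finset.range N, s ≠ -(r : ℂ) := by
    refine (eventually_all_finset _).2 fun r _ => ?_
    by_cases hr : s₀ = -(r : ℂ)
    · rw [← hr]
      exact self_mem_nhdsWithin
    · exact (eventually_ne_nhds hr).filter_mono nhdsWithin_le_nhds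
  have h2 : ∀ᶠ s in 𝓝[≠] s₀, s ∈ Metric.ball s₀ 1 :=
    Filter.Eventually.filter_mono nhdsWithin_le_nhds (Metric.ball_mem_nhds s₀ one_pos)
  filter_upwards [h1, h2] with s hs1 hs2 r h0
  have hr : s = -(r : ℂ) := eq_neg_of_add_eq_zero_left h0
  refine hs1 r (Finset.mem_range.2 ?_) hr
  rw [mem_ball_iff_norm] at hs2
  have h3 := norm_le_norm_add_norm_sub' s s₀
  have h4 : ‖s‖ = r := by rw [hr, norm_neg, Complex.norm_natCast]
  have : (r : ℝ) < N := by linarith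
  exact_mod_cast this

/-- The summand of the formula is a beta value, since `Γ(δ l + 1) = δ l Γ(δ l)`. -/
theorem Gamma_one_sub_mul_gammaTerm {q : ℝ} (hq : 0 < q) (hq1 : q ≠ 1) {s : ℂ} (hs : s.re < 0)
    (z : ℂ) {l : ℤ} (hl : l ≠ 0) (h : ∀ r : ℕ, s + qDelta q * l + r ≠ 0) :
    Complex.Gamma (1 - s) * gammaTerm q z s l = qDelta q *
      (betaSeries s (s + qDelta q * l) * Complex.exp (-2 * Real.pi * Complex.I * l * z)) := by
  have hd : qDelta q ≠ 0 := by
    have := Real.log_ne_zero_of_pos_of_ne_one hq hq1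
    have := Real.pi_ne_zero
    simp [qDelta, *]
  have hl' : (l : ℂ) ≠ 0 := by exact_mod_cast hl
  rw [gammaTerm, betaSeries_eq_Gamma hs h,
    show s + qDelta q * l + 1 - s = qDelta q * l + 1 by ring,
    Complex.Gamma_add_one _ (mul_ne_zero hd hl')]
  field_simp

theorem norm_exp_neg_two_pi_I_mul (l : ℤ) (z : ℝ) :
    ‖Complex.exp (-2 * Real.pi * Complex.I * l * z)‖ = 1 := by
  rw [show -2 * Real.pi * Complex.I * l * z = ((-2 * Real.pi * l * z : ℝ) : ℂ) * Complex.I by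
    push_cast; ring]
  exact Complex.norm_exp_ofReal_mul_I _

theorem continuousAt_tsum_betaSeries {q : ℝ} (hq : 0 < q) (hq1 : q < 1) {s₀ : ℂ} (hs : s₀.re < 0)
    (h : ∀ (r : ℕ) (l : ℤ), l ≠ 0 → s₀ + r + qDelta q * l ≠ 0) (z : ℝ) :
    ContinuousAt (fun s => ∑' l : {l : ℤ // l ≠ 0}, betaSeries s (s + qDelta q * (l : ℤ)) *
        Complex.exp (-2 * Real.pi * Complex.I * (l : ℤ) * z)) s₀ := by
  have hD : 2 * Real.pi / Real.log q ≠ 0 :=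
    div_ne_zero (by positivity) (Real.log_ne_zero_of_pos_of_ne_one hq hq1.ne)
  rw [qDelta_eq] at h ⊢
  obtain ⟨ε, hε, v, hv, hb⟩ := exists_summable_bound_betaSeries hs hD h
  refine ContinuousOn.continuousAt (s := Metric.closedBall s₀ ε) ?_
    (Metric.closedBall_mem_nhds s₀ hε)
  refine continuousOn_tsum (u := fun l : {l : ℤ // l ≠ 0} => v l) (fun l => ?_)
    (hv.comp_injective Subtype.val_injective) fun l s hs' => ?_
  · refine ContinuousOn.mul ?_ continuousOn_const
    set d : ℂ := ((2 * Real.pi / Real.log q : ℝ) : ℂ) * Complex.I with hd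
    refine ContinuousOn.congr (f := fun s => Complex.Gamma (s + d * (l : ℤ)) *
      Complex.Gamma (1 - s) / Complex.Gamma (d * (l : ℤ) + 1)) (fun s hs' => ?_) fun s hs' => ?_
    all_goals
      obtain ⟨hsre, hsl⟩ := hb s (mem_closedBall_iff_norm.1 hs')
      have hne := (hsl l l.2).1
    · refine ContinuousAt.continuousWithinAt (ContinuousAt.div_const (ContinuousAt.mul ?_ ?_) _)
      · exact ContinuousAt.comp' (f := fun s : ℂ => s + d * (l : ℤ))
          (Complex.differentiableAt_Gamma _ fun m hm => hne m (by rw [hm]; ring)).continuousAt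
          (by fun_prop)
      · exact ContinuousAt.comp' (f := fun s : ℂ => 1 - s)
          (Complex.differentiableAt_Gamma _ fun m hm => by
            have h1 := congrArg Complex.re hm
            have : (0 : ℝ) ≤ m := Nat.cast_nonneg m
            simp at h1
            linarith).continuousAt (by fun_prop)
    · simp only
      rw [betaSeries_eq_Gamma hsre hne, show s + d * (l : ℤ) + 1 - s = d * (l : ℤ) + 1 by ring]
  · rw [norm_mul, norm_exp_neg_two_pi_I_mul, mul_one]
    exact ((hb s (mem_closedBall_iff_norm.1 hs')).2 l l.2).2

/-- On a punctured neighbourhood of `s₀` the function `ζ*` is given by the beta series. -/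
theorem qHurwitzZetaStar_eventuallyEq {q : ℝ} (hq : 0 < q) (hq1 : q < 1) {z : ℝ} (hz0 : 0 < z)
    (hz1 : z ≤ 1) {s₀ : ℂ} (hs : s₀.re < 0)
    (h : ∀ (r : ℕ) (l : ℤ), l ≠ 0 → s₀ + r + qDelta q * l ≠ 0) :
    qHurwitzZetaStar q z =ᶠ[𝓝[≠] s₀] fun s => qFactor q z s * (-(1 / (Real.log q : ℂ)) *
      ∑' l : {l : ℤ // l ≠ 0}, betaSeries s (s + qDelta q * (l : ℤ)) *
        Complex.exp (-2 * Real.pi * Complex.I * (l : ℤ) * z)) := by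
  have hD : 2 * Real.pi / Real.log q ≠ 0 :=
    div_ne_zero (by positivity) (Real.log_ne_zero_of_pos_of_ne_one hq hq1.ne)
  have hm : MeromorphicOn (fun s : ℂ => qHurwitzZeta q z s +
      qFactor q z s / (Real.log q : ℂ) * ((Real.pi : ℂ) / Complex.sin ((Real.pi : ℂ) * s)))
      Set.univ := fun s hs =>
    ((isQHurwitzContinuation_qHurwitzZeta hq hq1 hz0).1.meromorphicOn s hs).fun_add
      (((((differentiable_qFactor hq hq1 z).div_const _).analyticAt s).meromorphicAt).fun_mul
        ((MeromorphicAt.const _ _).fun_div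
          (Differentiable.analyticAt (by fun_prop) s).meromorphicAt))
  have hne : ∀ᶠ s in 𝓝[≠] s₀, s.re < 0 ∧ ∀ (r : ℕ) (l : ℤ), l ≠ 0 → s + r + qDelta q * l ≠ 0 := by
    rw [qDelta_eq] at h ⊢
    obtain ⟨ε, hε, v, -, hb⟩ := exists_summable_bound_betaSeries hs hD h
    have : ∀ᶠ s in 𝓝[≠] s₀, s ∈ Metric.closedBall s₀ ε :=
      Filter.Eventually.filter_mono nhdsWithin_le_nhds (Metric.closedBall_mem_nhds s₀ hε)
    filter_upwards [this] with s hs'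
    obtain ⟨h1, h2⟩ := hb s (mem_closedBall_iff_norm.1 hs')
    refine ⟨h1, fun r l hl h0 => (h2 l hl).1 r ?_⟩
    rw [← h0]
    ring
  filter_upwards [hm.toMeromorphicNFOn_eq_self_on_nhdsNE (Set.mem_univ s₀), hne,
    eventually_add_natCast_ne_zero s₀, qHurwitzZeta_eventuallyEq hq hq1 hz0 s₀]
    with s h1 h2 h3 h4
  have h5 : ∀ (r : ℕ) (l : ℤ), s + r + qDelta q * l ≠ 0 := fun r l => by
    by_cases hl : l = 0
    · simpa [hl] using h3 r
    · exact h2.2 r l hl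
  rw [← qSeries_add_eq_tsum hq hq1 h2.1 h5 hz0.le hz1, qHurwitzZetaStar, h1, h4]
  ring

theorem mainTheorem4 (q : ℝ) (hq0 : 0 < q) (hq1 : q < 1) (z : ℝ) (hz0 : 0 < z) (hz1 : z ≤ 1) :
    IsQHurwitzContinuation q (z : ℂ) (qHurwitzZeta q (z : ℂ)) ∧
    ∀ s : ℂ, s.re < 0 →
      (∀ (r : ℕ) (l : ℤ), 1 ≤ r → l ≠ 0 → s ≠ -(r : ℂ) + qDelta q * (l : ℂ)) →
      AnalyticAt ℂ (qHurwitzZetaStar q (z : ℂ)) s ∧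
      Summable (fun l : {l : ℤ // l ≠ 0} => gammaTerm q (z : ℂ) s (l : ℤ)) ∧
      qHurwitzZetaStar q (z : ℂ) s =
        -(1 / (2 * (Real.pi : ℂ) * Complex.I)) * qFactor q (z : ℂ) s * Complex.Gamma (1 - s) *
          ∑' l : {l : ℤ // l ≠ 0}, gammaTerm q (z : ℂ) s (l : ℤ) := by
  refine ⟨isQHurwitzContinuation_qHurwitzZeta hq0 hq1 hz0, fun s hs hexc => ?_⟩
  have h := add_natCast_add_qDelta_mul_ne_zero hs hexc
  have hcont := ((differentiable_qFactor hq0 hq1 z).continuous.continuousAt (x := s)).fun_mul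
    ((continuousAt_tsum_betaSeries hq0 hq1 hs h z).const_mul (-(1 / (Real.log q : ℂ))))
  have heq := qHurwitzZetaStar_eventuallyEq hq0 hq1 hz0 hz1 hs h
  have hNF : MeromorphicNFAt (qHurwitzZetaStar q z) s :=
    meromorphicNFOn_toMeromorphicNFOn _ _ (Set.mem_univ s)
  -- `ζ*` has a finite limit at `s`, so a meromorphic normal form is analytic with that value.
  have hlim := (hcont.tendsto.mono_left nhdsWithin_le_nhds).congr' heq.symm
  have hana : AnalyticAt ℂ (qHurwitzZetaStar q z) s :=
    hNF.meromorphicOrderAt_nonneg_iff_analyticAt.1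
      ((tendsto_nhds_iff_meromorphicOrderAt_nonneg hNF.meromorphicAt).1 ⟨_, hlim⟩)
  have hval := tendsto_nhds_unique (hana.continuousAt.tendsto.mono_left nhdsWithin_le_nhds) hlim
  have hGamma : Complex.Gamma (1 - s) ≠ 0 :=
    Complex.Gamma_ne_zero_of_re_pos (by simp; linarith)
  have hterm : ∀ l : {l : ℤ // l ≠ 0}, Complex.Gamma (1 - s) * gammaTerm q z s l = qDelta q *
      (betaSeries s (s + qDelta q * (l : ℤ)) *
        Complex.exp (-2 * Real.pi * Complex.I * (l : ℤ) * z)) := fun l =>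
    Gamma_one_sub_mul_gammaTerm hq0 hq1.ne hs z l.2 fun r h0 => h r l l.2 (by rw [← h0]; ring)
  refine ⟨hana, ?_, ?_⟩
  · rw [← summable_mul_left_iff hGamma]
    simp_rw [hterm]
    refine Summable.mul_left _ (Summable.of_norm ?_)
    simp_rw [norm_mul, norm_exp_neg_two_pi_I_mul, mul_one]
    exact (summable_betaSeries_qDelta hq0 hq1 hs h).norm.comp_injective Subtype.val_injective
  · have hpi : (Real.pi : ℂ) ≠ 0 := by exact_mod_cast Real.pi_ne_zero
    have hd : 1 / (2 * (Real.pi : ℂ) * Complex.I) * qDelta q = 1 / (Real.log q : ℂ) := by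
      rw [qDelta]
      field_simp
    rw [hval, ← hd, mul_assoc (-(1 / (2 * (Real.pi : ℂ) * Complex.I)) * qFactor q z s),
      ← tsum_mul_left (a := Complex.Gamma (1 - s))]
    simp_rw [hterm]
    rw [tsum_mul_left (a := qDelta q)]
    ring

end
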